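/- Let $\mathbb H^2$ be the hyperbolic plane of constant curvature $-1$, let $\alpha<0$ and $T\in(0,\infty]$, and let $X:S^1\times[0,T)\to\mathbb H^2$ be a smooth family of regular closed curves $\gamma_t=X(S^1,t)$ solving $$\frac{\partial X}{\partial t}=\bigl(\phi(t)-\kappa^{\alpha}\bigr)\nu,\qquad X(\cdot,0)=X_0 .$$ Here $s$ is arclength and $\nu$ is a unit normal along the curves, depending continuously on $(u,t)$ (for embedded curves, the inner one). The curvature $\kappa$ is taken with respect to $\nu$, i.e. $\nabla_s\mathbf t=\kappa\nu$ for the unit tangent $\mathbf t$. The function $\phi$ is one of $$\phi_1(t)=\frac{1}{L(t)}\int_{\gamma_t}\kappa^{\alpha}\,ds\qquad\text{or}\qquad \phi_2(t)=\frac{1}{\int_{\gamma_t}\kappa\,ds}\int_{\gamma_t}\kappa^{\alpha+1}\,ds ,$$ where $L(t)$ is the length of $\gamma_t$. A smooth closed curve is called convex if $\kappa>0$ everywhere on it. If the initial curve $X_0$ is smooth, closed and convex, then $\gamma_t$ is convex for all $t\in(0,T)$. More precisely, $m:=\min_{S^1}\kappa(\cdot,0)$ is attained and positive, and $$\kappa(u,t)\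 \ge\ \min\{m,\,1\}\qquad\text{for all }u\in S^1,\ t\in(0,T).$$ -/

import Mathlib

open Set
open scoped UpperHalfPlane ContDiff

noncomputable section

namespace HypFlow

/-! The hyperbolic plane `ℍ²` is the upper half-plane `ℍ` with the metric `(dx² + dy²) / y²` of
curvature `-1`.  Tangent vectors at a point are complex numbers.  A closed curve `S¹ → ℍ²` is a
`2π`-periodic map `γ : ℝ → ℍ`. -/

/-- The hyperbolic inner product of two tangent vectors at `z`. -/
def metric (z : ℍ) (v w : ℂ) : ℝ := (v.re * w.re + v.im * w.im) / z.im ^ 2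

/-- The velocity `γ'(u)` in the coordinate of the half-plane. -/
def velocity (γ : ℝ → ℍ) (u : ℝ) : ℂ := deriv (fun x => (γ x : ℂ)) u

/-- The hyperbolic length of the velocity; the arclength element is `ds = speed du`. -/
def speed (γ : ℝ → ℍ) (u : ℝ) : ℝ := √(metric (γ u) (velocity γ u) (velocity γ u))

/-- The unit tangent vector. -/
def tangent (γ : ℝ → ℍ) (u : ℝ) : ℂ := (speed γ u)⁻¹ • velocity γ u

/-- The Levi-Civita covariant derivative of a vector field `V` along `γ` with respect to the
parameter.  With `z = x + i y`, the Christoffel symbols of the half-plane,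
`Γˣ_xy = Γˣ_yx = -1/y`, `Γʸ_xx = 1/y`, `Γʸ_yy = -1/y` and all others zero, amount to the complex
bilinear expression `Γ(v, w) = (i / y) v w`. -/
def covDeriv (γ : ℝ → ℍ) (V : ℝ → ℂ) (u : ℝ) : ℂ :=
  deriv V u + Complex.I / ((γ u).im : ℂ) * velocity γ u * V u

/-- A unit normal field along `γ`.  A regular curve has exactly two continuous ones, the tangent
turned by `± π/2`; the sign `σ` says which.  For a simple closed curve the inner normal is the one
with `σ = 1` or the one with `σ = -1`, according to whether the parametrization runs
counterclockwise or clockwise. -/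
def normal (σ : ℤˣ) (γ : ℝ → ℍ) (u : ℝ) : ℂ := ((σ : ℤ) : ℂ) * Complex.I * tangent γ u

/-- The geodesic curvature with respect to the chosen unit normal `ν`, that is, the `κ` with
`∇_s 𝐭 = κ ν`. -/
def curvature (σ : ℤˣ) (γ : ℝ → ℍ) (u : ℝ) : ℝ :=
  metric (γ u) ((speed γ u)⁻¹ • covDeriv γ (tangent γ) u) (normal σ γ u)

/-- A smooth closed (regular) curve in the hyperbolic plane. -/
structure IsSmoothClosedCurve (γ : ℝ → ℍ) : Prop where
  periodic : Function.Periodic γ (2 * Real.pi)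
  smooth : ContDiff ℝ ∞ (fun u => (γ u : ℂ))
  regular : ∀ u, velocity γ u ≠ 0

/-- Convexity: the curvature is positive everywhere. -/
def IsConvex (σ : ℤˣ) (γ : ℝ → ℍ) : Prop := ∀ u, 0 < curvature σ γ u

/-- The integral `∫_γ f ds` with respect to arclength over one period. -/
def curveIntegral (γ : ℝ → ℍ) (f : ℝ → ℝ) : ℝ :=
  ∫ u in (0 : ℝ)..(2 * Real.pi), f u * speed γ u

/-- The length of a closed curve. -/
def length (γ : ℝ → ℍ) : ℝ := curveIntegral γ (fun _ => 1)

/-- The two kinds of flow. -/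
inductive FlowKind where
  | areaPreserving
  | lengthPreserving

/-- The nonlocal term `φ` of the flow:
`(1 / L) ∫ κ^α ds` in the area-preserving case and
`(∫ κ ds)⁻¹ ∫ κ^(α+1) ds` in the length-preserving case. -/
def phi (i : FlowKind) (α : ℝ) (σ : ℤˣ) (γ : ℝ → ℍ) : ℝ :=
  match i with
  | .areaPreserving =>
      1 / length γ * curveIntegral γ (fun u => curvature σ γ u ^ α)
  | .lengthPreserving =>
      1 / curveIntegral γ (curvature σ γ) * curveIntegral γ (fun u => curvature σ γ u ^ (α + 1))

/-- The time interval `[0, T)`, where `T` may be infinite. -/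
def timeInterval (T : EReal) : Set ℝ := {t | 0 ≤ t ∧ (t : EReal) < T}

/-- `X : [0, T) × S¹ → ℍ²` is a smooth solution of the flow
`∂X/∂t = (φ(t) - κ^α) ν`, `X(0, ·) = X₀`, through regular closed curves `γ_t = X t`.
No sign of the curvature is required at any time. -/
structure IsSolution (i : FlowKind) (α : ℝ) (σ : ℤˣ) (T : EReal) (X₀ : ℝ → ℍ)
    (X : ℝ → ℝ → ℍ) : Prop where
  smooth : ContDiffOn ℝ ∞ (fun p : ℝ × ℝ => (X p.1 p.2 : ℂ)) (timeInterval T ×ˢ univ)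
  closed : ∀ t ∈ timeInterval T, IsSmoothClosedCurve (X t)
  flow : ∀ t ∈ timeInterval T, ∀ u,
    HasDerivWithinAt (fun τ => (X τ u : ℂ))
      ((phi i α σ (X t) - curvature σ (X t) u ^ α) • normal σ (X t) u) (timeInterval T) t
  initial : X 0 = X₀

end HypFlow

end

/-! With `F = φ - κ^α`, the curvature evolves by `∂κ/∂t = F_ss + F (κ² - 1)` at points where `κ` and
`F` are spatially critical. At a spatial minimum of `κ` with value in `(0, 1)`, `α < 0` makes `κ^α`
maximal, so `F` is minimal and `F_ss ≥ 0`. Both choices of `φ` are weighted means of `κ^α`, with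
weight `ds` or `κ ds`, so `F ≤ 0` there; as `κ² < 1`, both terms are nonnegative. Thus the minimum
of `κ` cannot fall below `min m 1`. The evolution equation is `IsSolution.hasDerivAt_curvature`, the
sign of `F` is `IsSmoothClosedCurve.flowSpeed_nonpos`, and the minimum principle is
`le_of_deriv_nonneg_at_min`. Convexity at later times is never presupposed: at the minima that
matter the value is positive, which makes that whole curve convex. -/

noncomputable section
namespace HypFlow

/-! ### Curvature and normal in half-plane coordinates. -/

/-- The curvature of a curve in the half-plane as a function of its height `y`, its velocity `v`
and its coordinate acceleration `a`. -/
def coordCurvature (σ : ℤˣ) (y : ℝ) (v a : ℂ) : ℝ :=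
  ((σ : ℤ) : ℝ) * (y * (v.re * a.im - v.im * a.re) / ‖v‖ ^ 3 + v.re / ‖v‖)

/-- The unit normal as a function of the height `y` and the velocity `v`. -/
def coordNormal (σ : ℤˣ) (y : ℝ) (v : ℂ) : ℂ :=
  ((σ : ℤ) : ℂ) * Complex.I * (((y / ‖v‖ : ℝ) : ℂ) * v)

lemma norm_sq_eq (v : ℂ) : ‖v‖ ^ 2 = v.re ^ 2 + v.im ^ 2 := by
  rw [← Complex.normSq_eq_norm_sq, Complex.normSq_apply]; ring

lemma hasDerivAt_re {v : ℝ → ℂ} {a : ℂ} {u : ℝ} (h : HasDerivAt v a u) :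
    HasDerivAt (fun x => (v x).re) a.re u :=
  (Complex.reCLM.hasFDerivAt.comp_hasDerivAt u h)

lemma hasDerivAt_im {v : ℝ → ℂ} {a : ℂ} {u : ℝ} (h : HasDerivAt v a u) :
    HasDerivAt (fun x => (v x).im) a.im u :=
  (Complex.imCLM.hasFDerivAt.comp_hasDerivAt u h)

lemma hasDerivAt_norm {v : ℝ → ℂ} {a : ℂ} {u : ℝ} (h : HasDerivAt v a u) (hv : v u ≠ 0) :
    HasDerivAt (fun x => ‖v x‖) (((v u).re * a.re + (v u).im * a.im) / ‖v u‖) u := by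
  have hn : 0 < ‖v u‖ := norm_pos_iff.2 hv
  have h1 := ((hasDerivAt_re h).pow 2).add ((hasDerivAt_im h).pow 2)
  have hne : (v u).re ^ 2 + (v u).im ^ 2 ≠ 0 := by rw [← norm_sq_eq]; positivity
  have h2 := h1.sqrt (by simpa using hne)
  have e : (fun x => ‖v x‖) = fun x => √((v x).re ^ 2 + (v x).im ^ 2) := by
    funext x; rw [← norm_sq_eq, Real.sqrt_sq (norm_nonneg _)]
  rw [e]
  refine h2.congr_deriv ?_
  simp only [Pi.add_apply, Pi.pow_apply]
  rw [← norm_sq_eq, Real.sqrt_sq (norm_nonneg _)]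
  field_simp
  ring

lemma speed_eq (γ : ℝ → ℍ) (u : ℝ) : speed γ u = ‖velocity γ u‖ / (γ u).im := by
  have := (γ u).im_pos
  rw [speed, metric, ← sq, ← sq, ← norm_sq_eq, Real.sqrt_div (by positivity),
    Real.sqrt_sq (norm_nonneg _), Real.sqrt_sq this.le]

lemma tangent_eq (γ : ℝ → ℍ) (u : ℝ) :
    tangent γ u = (((γ u).im / ‖velocity γ u‖ : ℝ) : ℂ) * velocity γ u := by
  rw [tangent, speed_eq, inv_div, Complex.real_smul]

lemma normal_eq (σ : ℤˣ) (γ : ℝ → ℍ) (u : ℝ) :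
    normal σ γ u = coordNormal σ (γ u).im (velocity γ u) := by
  rw [normal, tangent_eq, coordNormal]

lemma curvature_eq (σ : ℤˣ) {γ : ℝ → ℍ} {u : ℝ} {a : ℂ}
    (hd : DifferentiableAt ℝ (fun x => (γ x : ℂ)) u)
    (hv : velocity γ u ≠ 0) (ha : HasDerivAt (velocity γ) a u) :
    curvature σ γ u = coordCurvature σ (γ u).im (velocity γ u) a := by
  have hy := (γ u).im_pos
  have hn : 0 < ‖velocity γ u‖ := norm_pos_iff.2 hv
  -- The value of `c` is irrelevant: it multiplies a tangential vector, which is orthogonal to the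
  -- normal.
  have hc : ∃ c, HasDerivAt (fun x => (γ x).im / ‖velocity γ x‖) c u :=
    ⟨_, (hasDerivAt_im (v := fun x => (γ x : ℂ)) hd.hasDerivAt).div (hasDerivAt_norm ha hv) hn.ne'⟩
  obtain ⟨c, hc⟩ := hc
  have ht : HasDerivAt (tangent γ) ((c : ℂ) * velocity γ u + (((γ u).im / ‖velocity γ u‖ : ℝ) : ℂ) * a) u := by
    rw [funext (tangent_eq γ)]; exact hc.ofReal_comp.mul ha
  rw [curvature, covDeriv, ht.deriv, speed_eq, normal_eq, tangent_eq, coordCurvature, coordNormal,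
    metric]
  have hN := norm_sq_eq (velocity γ u)
  generalize velocity γ u = v at *
  generalize (γ u).im = y at *
  generalize ‖v‖ = n at *
  obtain ⟨p, q⟩ := v
  obtain ⟨r, s⟩ := a
  simp only at hN ⊢
  have h3 : Complex.I / (y : ℂ) = ⟨0, y⁻¹⟩ := by
    apply Complex.ext <;> simp [Complex.div_re, Complex.div_im, Complex.normSq_apply]
  rw [h3]
  rcases Int.units_eq_one_or σ with rfl | rfl <;>
  · simp
    field_simp
    first | linear_combination (-p) * hN | linear_combination p * hN

lemma hasDerivAt_coordCurvature (σ : ℤˣ) {y : ℝ → ℝ} {v a : ℝ → ℂ} {y' : ℝ} {v' a' : ℂ} {t : ℝ}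
    (hy : HasDerivAt y y' t) (hv : HasDerivAt v v' t) (ha : HasDerivAt a a' t) (h0 : v t ≠ 0) :
    HasDerivAt (fun x => coordCurvature σ (y x) (v x) (a x))
      (((σ : ℤ) : ℝ) * ((y' * ((v t).re * (a t).im - (v t).im * (a t).re)
        + y t * (v'.re * (a t).im + (v t).re * a'.im - v'.im * (a t).re - (v t).im * a'.re))
          / ‖v t‖ ^ 3
        - 3 * y t * ((v t).re * (a t).im - (v t).im * (a t).re)
          * ((v t).re * v'.re + (v t).im * v'.im) / ‖v t‖ ^ 5
        + v'.re / ‖v t‖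
        - (v t).re * ((v t).re * v'.re + (v t).im * v'.im) / ‖v t‖ ^ 3)) t := by
  have hn : 0 < ‖v t‖ := norm_pos_iff.2 h0
  have hN := hasDerivAt_norm hv h0
  have key := (((hy.mul (((hasDerivAt_re hv).mul (hasDerivAt_im ha)).sub
    ((hasDerivAt_im hv).mul (hasDerivAt_re ha)))).div (hN.pow 3) (pow_pos hn 3).ne').add
    ((hasDerivAt_re hv).div hN hn.ne')).const_mul ((σ : ℤ) : ℝ)
  refine key.congr_deriv ?_
  simp only [Pi.mul_apply, Pi.sub_apply, Pi.pow_apply]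
  congr 1
  field_simp
  ring

/-- Weingarten's equation `∇_u ν = -κ v`, solved for the ordinary derivative by moving the
Christoffel term across. -/
lemma hasDerivAt_coordNormal (σ : ℤˣ) {y : ℝ → ℝ} {v : ℝ → ℂ} {a : ℂ} {u : ℝ}
    (hy : HasDerivAt y (v u).im u) (hv : HasDerivAt v a u) (hpos : 0 < y u) (h0 : v u ≠ 0) :
    HasDerivAt (fun x => coordNormal σ (y x) (v x))
      (-(coordCurvature σ (y u) (v u) a : ℂ) * v u
        - Complex.I * (((y u)⁻¹ : ℝ) : ℂ) * (v u * coordNormal σ (y u) (v u))) u := by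
  have hn : 0 < ‖v u‖ := norm_pos_iff.2 h0
  have key := ((hy.div (hasDerivAt_norm hv h0) hn.ne').ofReal_comp.mul hv).const_mul
    (((σ : ℤ) : ℂ) * Complex.I)
  refine key.congr_deriv ?_
  rw [coordCurvature, coordNormal]
  have hN := norm_sq_eq (v u)
  simp only [Pi.div_apply]
  generalize v u = v at *
  generalize y u = y at *
  generalize ‖v‖ = n at *
  obtain ⟨p, q⟩ := v
  obtain ⟨r, s⟩ := a
  simp only at hN ⊢
  generalize hc : (q * n - y * ((p * r + q * s) / n)) / n ^ 2 = c
  generalize hk : ((σ : ℤ) : ℝ) * (y * (p * s - q * r) / n ^ 3 + p / n) = k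
  generalize hd : y / n = d
  generalize hi : y⁻¹ = i
  rcases Int.units_eq_one_or σ with rfl | rfl <;>
  · apply Complex.ext
    all_goals
      simp
      simp at hk
      subst hc hk hd hi
      field_simp
      ring_nf
      simp only [hN]
      ring

/-- The algebra behind the evolution equation `∂κ/∂t = F_ss + F (κ² - 1)` at a critical point of
`F` and `κ`. -/
lemma coordCurvature_variation (σ : ℤˣ) {y k F F2 : ℝ} {v a N N1 N2 : ℂ} (hy : 0 < y) (hv : v ≠ 0)
    (hk : k = coordCurvature σ y v a) (hN : N = coordNormal σ y v)
    (hN1 : N1 = -(k : ℂ) * v - Complex.I * ((y⁻¹ : ℝ) : ℂ) * (v * N))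
    (hN2 : N2 = -(k : ℂ) * a - Complex.I * (((-v.im / y ^ 2 : ℝ) : ℂ) * (v * N)
      + ((y⁻¹ : ℝ) : ℂ) * (a * N + v * N1))) :
    ((σ : ℤ) : ℝ) * (((F * N.im) * (v.re * a.im - v.im * a.re)
        + y * ((F * N1.re) * a.im + v.re * (F2 * N.im + F * N2.im) - (F * N1.im) * a.re
          - v.im * (F2 * N.re + F * N2.re))) / ‖v‖ ^ 3
        - 3 * y * (v.re * a.im - v.im * a.re)
          * (v.re * (F * N1.re) + v.im * (F * N1.im)) / ‖v‖ ^ 5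
        + (F * N1.re) / ‖v‖
        - v.re * (v.re * (F * N1.re) + v.im * (F * N1.im)) / ‖v‖ ^ 3)
      = F2 * (y / ‖v‖) ^ 2 + F * (k ^ 2 - 1) := by
  -- `N1` and `N2` are the first two parameter derivatives of the normal, `N2` without the `κ_u`
  -- term. With `F_u = 0`, position, velocity and acceleration vary by `F N`, `F N1` and `F2 N + F
  -- N2`.
  have hn : 0 < ‖v‖ := norm_pos_iff.2 hv
  have hM := norm_sq_eq v
  rw [coordCurvature] at hk
  rw [coordNormal] at hN
  generalize ‖v‖ = n at *
  obtain ⟨p, q⟩ := v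
  obtain ⟨r, s⟩ := a
  simp only at hM hk
  have e1 : N.re = -((σ : ℤ) : ℝ) * (y / n * q) := by subst hN; simp
  have e2 : N.im = ((σ : ℤ) : ℝ) * (y / n * p) := by subst hN; simp
  have e3 : N1.re = -k * p + y⁻¹ * (p * N.im + q * N.re) := by subst hN1; simp
  have e4 : N1.im = -k * q - y⁻¹ * (p * N.re - q * N.im) := by subst hN1; simp
  have e5 : N2.re = -k * r + (-q / y ^ 2 * (p * N.im + q * N.re)
      + y⁻¹ * (r * N.im + s * N.re + p * N1.im + q * N1.re)) := by subst hN2; generalize -q / y ^ 2 = c; simp; ring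
  have e6 : N2.im = -k * s - (-q / y ^ 2 * (p * N.re - q * N.im)
      + y⁻¹ * (r * N.re - s * N.im + p * N1.re - q * N1.im)) := by subst hN2; generalize -q / y ^ 2 = c; simp; left; ring
  rw [e5, e6, e3, e4, e1, e2, hk]
  clear hk hN hN1 hN2 e1 e2 e3 e4 e5 e6
  have h4 : n ^ 4 = (p ^ 2 + q ^ 2) ^ 2 := by rw [← hM]; ring
  have h6 : n ^ 6 = (p ^ 2 + q ^ 2) ^ 3 := by rw [← hM]; ring
  have h8 : n ^ 8 = (p ^ 2 + q ^ 2) ^ 4 := by rw [← hM]; ring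
  rcases Int.units_eq_one_or σ with rfl | rfl
  · simp only [Units.val_one, Int.cast_one, one_mul]
    field_simp
    ring_nf
    simp only [h4, h6, h8, hM]
    ring
  · simp only [Units.val_neg, Units.val_one, Int.cast_neg, Int.cast_one]
    field_simp
    ring_nf
    simp only [h4, h6, h8, hM]
    ring

/-! ### Calculus on the space-time strip, including its initial boundary. -/

lemma convex_timeInterval (T : EReal) : Convex ℝ (timeInterval T) := by
  refine Set.OrdConnected.convex ⟨fun a ha b hb c hc => ⟨ha.1.trans hc.1, ?_⟩⟩
  exact lt_of_le_of_lt (EReal.coe_le_coe_iff.2 hc.2) hb.2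

lemma timeInterval_mem_nhds {T : EReal} {t : ℝ} (h0 : 0 < t) (hT : (t : EReal) < T) :
    timeInterval T ∈ nhds t := by
  obtain ⟨r, hr1, hr2⟩ := EReal.lt_iff_exists_real_btwn.1 hT
  filter_upwards [Ioo_mem_nhds h0 (EReal.coe_lt_coe_iff.1 hr1)] with x hx
  exact ⟨hx.1.le, lt_trans (EReal.coe_lt_coe_iff.2 hx.2) hr2⟩

lemma nonempty_interior_timeInterval {T : EReal} (hT : 0 < T) :
    (interior (timeInterval T)).Nonempty := by
  obtain ⟨r, hr1, hr2⟩ := EReal.lt_iff_exists_real_btwn.1 hT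
  exact ⟨r, mem_interior_iff_mem_nhds.2
    (timeInterval_mem_nhds (EReal.coe_lt_coe_iff.1 (by simpa using hr1)) hr2)⟩

/-- The space-time strip over a set of times. -/
def strip (I : Set ℝ) : Set (ℝ × ℝ) := I ×ˢ univ

lemma nonempty_interior_strip {T : EReal} (hT : 0 < T) :
    (interior (strip (timeInterval T))).Nonempty := by
  rw [strip, interior_prod_eq, interior_univ]
  exact (nonempty_interior_timeInterval hT).prod univ_nonempty

lemma convex_strip (T : EReal) : Convex ℝ (strip (timeInterval T)) :=
  (convex_timeInterval T).prod convex_univ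

lemma uniqueDiffOn_strip {T : EReal} (hT : 0 < T) : UniqueDiffOn ℝ (strip (timeInterval T)) :=
  uniqueDiffOn_convex (convex_strip T) (nonempty_interior_strip hT)

/-- The derivative in the direction `e` within the set `S`. -/
def dirDeriv (S : Set (ℝ × ℝ)) (e : ℝ × ℝ) (f : ℝ × ℝ → ℂ) (p : ℝ × ℝ) : ℂ :=
  fderivWithin ℝ f S p e

lemma contDiffOn_dirDeriv {S : Set (ℝ × ℝ)} (hS : UniqueDiffOn ℝ S) {f : ℝ × ℝ → ℂ}
    (hf : ContDiffOn ℝ ∞ f S) (e : ℝ × ℝ) : ContDiffOn ℝ ∞ (dirDeriv S e f) S :=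
  (hf.fderivWithin hS (by simp)).clm_apply contDiffOn_const

/-- Symmetry of second derivatives extends to the boundary `t = 0` because the convex strip lies in
the closure of its interior. -/
lemma dirDeriv_comm {T : EReal} (hT : 0 < T) {f : ℝ × ℝ → ℂ}
    (hf : ContDiffOn ℝ ∞ f (strip (timeInterval T))) (e e' : ℝ × ℝ) {p : ℝ × ℝ}
    (hp : p ∈ strip (timeInterval T)) :
    dirDeriv (strip (timeInterval T)) e (dirDeriv (strip (timeInterval T)) e' f) p
      = dirDeriv (strip (timeInterval T)) e' (dirDeriv (strip (timeInterval T)) e f) p := by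
  have hS := uniqueDiffOn_strip hT
  have hd : DifferentiableWithinAt ℝ (fderivWithin ℝ f (strip (timeInterval T)))
      (strip (timeInterval T)) p :=
    (hf.fderivWithin (m := ∞) hS (by simp)).differentiableOn (by simp) p hp
  have key : ∀ d d' : ℝ × ℝ,
      dirDeriv (strip (timeInterval T)) d (dirDeriv (strip (timeInterval T)) d' f) p
        = fderivWithin ℝ (fderivWithin ℝ f (strip (timeInterval T))) (strip (timeInterval T))
          p d d' := by
    intro d d'
    have := (hd.hasFDerivWithinAt.clm_apply
      (hasFDerivWithinAt_const d' p (strip (timeInterval T)))).fderivWithin (hS p hp)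
    simp only [dirDeriv]
    change fderivWithin ℝ (fun y => fderivWithin ℝ f (strip (timeInterval T)) y d') _ p d = _
    rw [this]
    simp
  rw [key, key]
  refine (hf p hp).isSymmSndFDerivWithinAt
    (by simpa using WithTop.coe_le_coe.2 (le_top : (2 : ℕ∞) ≤ ⊤)) hS ?_ hp e e'
  rw [(convex_strip T).closure_interior_eq_closure_of_nonempty_interior
    (nonempty_interior_strip hT)]
  exact subset_closure hp

lemma hasDerivAt_space {I : Set ℝ} {f : ℝ × ℝ → ℂ} (hf : ContDiffOn ℝ ∞ f (strip I)) {t : ℝ}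
    (ht : t ∈ I) (u : ℝ) :
    HasDerivAt (fun x => f (t, x)) (dirDeriv (strip I) (0, 1) f (t, u)) u := by
  have h1 : HasFDerivWithinAt f (fderivWithin ℝ f (strip I) (t, u)) (strip I) (t, u) :=
    (hf.differentiableOn (by simp) (t, u) ⟨ht, mem_univ _⟩).hasFDerivWithinAt
  have h2 : HasDerivWithinAt (fun x : ℝ => (t, x)) ((0 : ℝ), (1 : ℝ)) univ u :=
    ((hasDerivAt_const u t).prodMk (hasDerivAt_id u)).hasDerivWithinAt
  have h3 : MapsTo (fun x : ℝ => (t, x)) univ (strip I) := fun x _ => ⟨ht, mem_univ _⟩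
  exact (h1.comp_hasDerivWithinAt u h2 h3).hasDerivAt Filter.univ_mem

lemma hasDerivWithinAt_time {I : Set ℝ} {f : ℝ × ℝ → ℂ} (hf : ContDiffOn ℝ ∞ f (strip I)) {t : ℝ}
    (ht : t ∈ I) (u : ℝ) :
    HasDerivWithinAt (fun x => f (x, u)) (dirDeriv (strip I) (1, 0) f (t, u)) I t := by
  have h1 : HasFDerivWithinAt f (fderivWithin ℝ f (strip I) (t, u)) (strip I) (t, u) :=
    (hf.differentiableOn (by simp) (t, u) ⟨ht, mem_univ _⟩).hasFDerivWithinAt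
  have h2 : HasDerivWithinAt (fun x : ℝ => (x, u)) ((1 : ℝ), (0 : ℝ)) I t :=
    ((hasDerivAt_id t).prodMk (hasDerivAt_const t u)).hasDerivWithinAt
  have h3 : MapsTo (fun x : ℝ => (x, u)) I (strip I) := fun x hx => ⟨hx, mem_univ _⟩
  exact h1.comp_hasDerivWithinAt t h2 h3

lemma contDiff_slice {I : Set ℝ} {E : Type*} [NormedAddCommGroup E] [NormedSpace ℝ E]
    {f : ℝ × ℝ → E} (hf : ContDiffOn ℝ ∞ f (strip I)) {t : ℝ} (ht : t ∈ I) :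
    ContDiff ℝ ∞ fun u => f (t, u) :=
  contDiffOn_univ.1 <| hf.comp ((contDiff_const.prodMk contDiff_id).contDiffOn)
    fun _ _ => ⟨ht, mem_univ _⟩

lemma contDiffOn_coordCurvature (σ : ℤˣ) {S : Set (ℝ × ℝ)} {z v a : ℝ × ℝ → ℂ}
    (hz : ContDiffOn ℝ ∞ z S) (hv : ContDiffOn ℝ ∞ v S) (ha : ContDiffOn ℝ ∞ a S)
    (h0 : ∀ p ∈ S, v p ≠ 0) :
    ContDiffOn ℝ ∞ (fun p => coordCurvature σ (z p).im (v p) (a p)) S := by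
  have re {g : ℝ × ℝ → ℂ} (hg : ContDiffOn ℝ ∞ g S) : ContDiffOn ℝ ∞ (fun p => (g p).re) S :=
    Complex.reCLM.contDiff.comp_contDiffOn hg
  have im {g : ℝ × ℝ → ℂ} (hg : ContDiffOn ℝ ∞ g S) : ContDiffOn ℝ ∞ (fun p => (g p).im) S :=
    Complex.imCLM.contDiff.comp_contDiffOn hg
  have hn : ContDiffOn ℝ ∞ (fun p => ‖v p‖) S := hv.norm ℝ h0
  have hn0 : ∀ p ∈ S, ‖v p‖ ≠ 0 := fun p hp => norm_ne_zero_iff.2 (h0 p hp)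
  exact contDiffOn_const.mul
    ((((im hz).mul (((re hv).mul (im ha)).sub ((im hv).mul (re ha)))).div (hn.pow 3)
      fun p hp => pow_ne_zero 3 (hn0 p hp)).add ((re hv).div hn hn0))

/-! ### The evolution equation of the curvature. -/

section Solution

variable {i : FlowKind} {α : ℝ} {σ : ℤˣ} {T : EReal} {X₀ : ℝ → ℍ} {X : ℝ → ℝ → ℍ}

/-- A family of curves as a complex-valued function of time and parameter. -/
def coordMap (X : ℝ → ℝ → ℍ) (p : ℝ × ℝ) : ℂ := X p.1 p.2

/-- The velocity of a family of curves as a function on space-time. -/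
def velMap (T : EReal) (X : ℝ → ℝ → ℍ) : ℝ × ℝ → ℂ :=
  dirDeriv (strip (timeInterval T)) (0, 1) (coordMap X)

/-- The coordinate acceleration of a family of curves as a function on space-time. -/
def accMap (T : EReal) (X : ℝ → ℝ → ℍ) : ℝ × ℝ → ℂ :=
  dirDeriv (strip (timeInterval T)) (0, 1) (velMap T X)

lemma IsSolution.contDiffOn (hX : IsSolution i α σ T X₀ X) :
    ContDiffOn ℝ ∞ (coordMap X) (strip (timeInterval T)) := hX.smooth

lemma IsSolution.contDiffOn_velMap (hX : IsSolution i α σ T X₀ X) (hT : 0 < T) :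
    ContDiffOn ℝ ∞ (velMap T X) (strip (timeInterval T)) :=
  contDiffOn_dirDeriv (uniqueDiffOn_strip hT) hX.contDiffOn _

lemma IsSolution.contDiffOn_accMap (hX : IsSolution i α σ T X₀ X) (hT : 0 < T) :
    ContDiffOn ℝ ∞ (accMap T X) (strip (timeInterval T)) :=
  contDiffOn_dirDeriv (uniqueDiffOn_strip hT) (hX.contDiffOn_velMap hT) _

lemma IsSolution.velocity_eq (hX : IsSolution i α σ T X₀ X) {t : ℝ} (ht : t ∈ timeInterval T)
    (u : ℝ) : velocity (X t) u = velMap T X (t, u) :=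
  (hasDerivAt_space hX.contDiffOn ht u).deriv

lemma IsSolution.velMap_ne_zero (hX : IsSolution i α σ T X₀ X) {t : ℝ}
    (ht : t ∈ timeInterval T) (u : ℝ) : velMap T X (t, u) ≠ 0 := by
  rw [← hX.velocity_eq ht]; exact (hX.closed t ht).regular u

lemma IsSolution.curvature_eq (hX : IsSolution i α σ T X₀ X) (hT : 0 < T) {t : ℝ}
    (ht : t ∈ timeInterval T) (u : ℝ) :
    curvature σ (X t) u
      = coordCurvature σ (coordMap X (t, u)).im (velMap T X (t, u)) (accMap T X (t, u)) := by
  rw [HypFlow.curvature_eq σ (a := accMap T X (t, u))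
    (hasDerivAt_space hX.contDiffOn ht u).differentiableAt ((hX.closed t ht).regular u),
    hX.velocity_eq ht]
  · rfl
  · rw [funext (hX.velocity_eq ht)]
    exact hasDerivAt_space (hX.contDiffOn_velMap hT) ht u

lemma IsSolution.contDiffOn_curvature (hX : IsSolution i α σ T X₀ X) (hT : 0 < T) :
    ContDiffOn ℝ ∞ (fun p : ℝ × ℝ => curvature σ (X p.1) p.2) (strip (timeInterval T)) :=
  (contDiffOn_coordCurvature σ hX.contDiffOn (hX.contDiffOn_velMap hT) (hX.contDiffOn_accMap hT)
    fun p hp => hX.velMap_ne_zero hp.1 p.2).congr fun p hp => hX.curvature_eq hT hp.1 p.2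

lemma IsSolution.hasDerivAt_normal (hX : IsSolution i α σ T X₀ X) (hT : 0 < T) {t : ℝ}
    (ht : t ∈ timeInterval T) (u : ℝ) :
    HasDerivAt (normal σ (X t)) (-(curvature σ (X t) u : ℂ) * velMap T X (t, u)
      - Complex.I * (((X t u).im⁻¹ : ℝ) : ℂ) * (velMap T X (t, u) * normal σ (X t) u)) u := by
  have h := hasDerivAt_coordNormal σ (hasDerivAt_im (hasDerivAt_space hX.contDiffOn ht u))
    (hasDerivAt_space (hX.contDiffOn_velMap hT) ht u) (X t u).im_pos (hX.velMap_ne_zero ht u)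
  have e : normal σ (X t)
      = fun x => coordNormal σ (coordMap X (t, x)).im (velMap T X (t, x)) := by
    funext x; rw [normal_eq, hX.velocity_eq ht]; rfl
  rw [e, hX.curvature_eq hT ht]
  exact h

/-- The normal speed `φ - κ^α` of the flow. -/
def flowSpeed (i : FlowKind) (α : ℝ) (σ : ℤˣ) (γ : ℝ → ℍ) (u : ℝ) : ℝ :=
  phi i α σ γ - curvature σ γ u ^ α

lemma IsSolution.timeDeriv_eq (hX : IsSolution i α σ T X₀ X) (hT : 0 < T) {t : ℝ}
    (ht : t ∈ timeInterval T) (u : ℝ) :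
    dirDeriv (strip (timeInterval T)) (1, 0) (coordMap X) (t, u)
      = (flowSpeed i α σ (X t) u : ℂ) * normal σ (X t) u := by
  have hI : UniqueDiffOn ℝ (timeInterval T) :=
    uniqueDiffOn_convex (convex_timeInterval T) (nonempty_interior_timeInterval hT)
  rw [← Complex.real_smul]
  exact (hI t ht).eq_deriv _ (hasDerivWithinAt_time hX.contDiffOn ht u) (hX.flow t ht u)

/-- The evolution equation `∂κ/∂t = F_ss + F (κ² - 1)` for `F = φ - κ^α`, at a point where `κ` and
`F` are critical in the space variable. -/
lemma IsSolution.hasDerivAt_curvature (hX : IsSolution i α σ T X₀ X) (hT : 0 < T) {t : ℝ}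
    (h0 : 0 < t) (ht : t ∈ timeInterval T) (hF : ContDiff ℝ ∞ (flowSpeed i α σ (X t))) {u : ℝ}
    (hκ : deriv (curvature σ (X t)) u = 0) (hF' : deriv (flowSpeed i α σ (X t)) u = 0) :
    HasDerivAt (fun τ => curvature σ (X τ) u)
      (deriv (deriv (flowSpeed i α σ (X t))) u * ((X t u).im / ‖velocity (X t) u‖) ^ 2
        + flowSpeed i α σ (X t) u * (curvature σ (X t) u ^ 2 - 1)) t := by
  set S := strip (timeInterval T) with hS
  set F := flowSpeed i α σ (X t) with hFdef
  set N := normal σ (X t) with hNdef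
  set κ := curvature σ (X t) with hκdef
  have hκd : HasDerivAt κ 0 u := by
    rw [← hκ]
    exact ((contDiff_slice (hX.contDiffOn_curvature hT) ht).differentiable (by simp) u).hasDerivAt
  let N1 : ℝ → ℂ := fun x => -(κ x : ℂ) * velMap T X (t, x)
      - Complex.I * (((X t x).im⁻¹ : ℝ) : ℂ) * (velMap T X (t, x) * N x)
  have hN : ∀ x, HasDerivAt N (N1 x) x := hX.hasDerivAt_normal hT ht
  have hz := fun x => hasDerivAt_space hX.contDiffOn ht x
  have hv := fun x => hasDerivAt_space (hX.contDiffOn_velMap hT) ht x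
  have hy := hasDerivAt_im (hz u)
  have hypos := (X t u).im_pos
  obtain ⟨N2, hN2⟩ : ∃ N2, N2 = -(κ u : ℂ) * accMap T X (t, u)
      - Complex.I * (((-(velMap T X (t, u)).im / (X t u).im ^ 2 : ℝ) : ℂ) * (velMap T X (t, u) * N u)
      + (((X t u).im⁻¹ : ℝ) : ℂ) * (accMap T X (t, u) * N u + velMap T X (t, u) * N1 u)) := ⟨_, rfl⟩
  have hN1 : HasDerivAt N1 N2 u := by
    have := (hκd.ofReal_comp.neg.mul (hv u)).sub
      (((hy.inv hypos.ne').ofReal_comp.const_mul Complex.I).mul ((hv u).mul (hN u)))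
    refine this.congr_deriv ?_
    rw [hN2]
    change -((0 : ℝ) : ℂ) * velMap T X (t, u) + -(κ u : ℂ) * accMap T X (t, u)
      - (Complex.I * ((-(velMap T X (t, u)).im / (X t u).im ^ 2 : ℝ) : ℂ)
          * (velMap T X (t, u) * N u)
        + Complex.I * (((X t u).im⁻¹ : ℝ) : ℂ)
          * (accMap T X (t, u) * N u + velMap T X (t, u) * N1 u)) = _
    rw [Complex.ofReal_zero]
    ring
  have hFd : ∀ x, HasDerivAt F (deriv F x) x := fun x =>
    (hF.differentiable (by simp) x).hasDerivAt
  have hFd2 : HasDerivAt (deriv F) (deriv (deriv F) u) u :=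
    ((contDiff_infty_iff_deriv.1 hF).2.differentiable (by simp) u).hasDerivAt
  -- By the flow equation `W = F N` on the whole slice, so its spatial derivatives follow from those
  -- of `F` and `N`; commuting derivatives then gives the time derivatives of velocity and
  -- acceleration.
  set W := dirDeriv S (1, 0) (coordMap X) with hW
  have hWs : ContDiffOn ℝ ∞ W S := contDiffOn_dirDeriv (uniqueDiffOn_strip hT) hX.contDiffOn _
  have hWt : ∀ x, W (t, x) = (F x : ℂ) * N x := hX.timeDeriv_eq hT ht
  have hWu : ∀ x, dirDeriv S (0, 1) W (t, x) = ((deriv F x : ℝ) : ℂ) * N x + (F x : ℂ) * N1 x := by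
    intro x
    have h1 := hasDerivAt_space hWs ht x
    rw [funext hWt] at h1
    exact h1.unique ((hFd x).ofReal_comp.mul (hN x))
  have hWuu : dirDeriv S (0, 1) (dirDeriv S (0, 1) W) (t, u)
      = ((deriv (deriv F) u : ℝ) : ℂ) * N u + (F u : ℂ) * N2 := by
    have h1 := hasDerivAt_space (contDiffOn_dirDeriv (uniqueDiffOn_strip hT) hWs (0, 1)) ht u
    rw [funext hWu] at h1
    rw [h1.unique ((hFd2.ofReal_comp.mul (hN u)).add ((hFd u).ofReal_comp.mul hN1)), hF']
    simp
  have hvt : ∀ p ∈ S, dirDeriv S (1, 0) (velMap T X) p = dirDeriv S (0, 1) W p := fun p hp =>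
    dirDeriv_comm hT hX.contDiffOn _ _ hp
  have hp : (t, u) ∈ S := ⟨ht, mem_univ _⟩
  have hat : dirDeriv S (1, 0) (accMap T X) (t, u) = dirDeriv S (0, 1) (dirDeriv S (0, 1) W) (t, u) := by
    rw [accMap, dirDeriv_comm hT (hX.contDiffOn_velMap hT) _ _ hp]
    unfold dirDeriv
    congr 1
    exact fderivWithin_congr hvt (hvt _ hp)
  -- Since `t > 0`, derivatives within the time interval are two-sided.
  have hnhds := timeInterval_mem_nhds h0 ht.2
  have d1 := (hasDerivWithinAt_time hX.contDiffOn ht u).hasDerivAt hnhds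
  have d2 := (hasDerivWithinAt_time (hX.contDiffOn_velMap hT) ht u).hasDerivAt hnhds
  have d3 := (hasDerivWithinAt_time (hX.contDiffOn_accMap hT) ht u).hasDerivAt hnhds
  have key := hasDerivAt_coordCurvature σ (hasDerivAt_im d1) d2 d3 (hX.velMap_ne_zero ht u)
  have hev : (fun τ => curvature σ (X τ) u) =ᶠ[nhds t] fun τ =>
      coordCurvature σ (coordMap X (τ, u)).im (velMap T X (τ, u)) (accMap T X (τ, u)) := by
    filter_upwards [hnhds] with τ hτ using hX.curvature_eq hT hτ u
  refine (key.congr_of_eventuallyEq hev).congr_deriv ?_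
  have alg := coordCurvature_variation σ (F := F u) (F2 := deriv (deriv F) u) hypos
    (hX.velMap_ne_zero ht u) (hX.curvature_eq hT ht u)
    (N := N u) (by rw [hNdef, normal_eq, hX.velocity_eq ht]) (N1 := N1 u) rfl hN2
  rw [hX.velocity_eq ht, ← alg]
  have e1 : dirDeriv S (1, 0) (coordMap X) (t, u) = (F u : ℂ) * N u := hWt u
  have e2 : dirDeriv S (1, 0) (velMap T X) (t, u) = (F u : ℂ) * N1 u := by
    rw [hvt _ hp, hWu, hF']; simp
  have e3 := hat.trans hWuu
  rw [← hS, e1, e2, e3]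
  simp only [coordMap, Complex.add_re, Complex.add_im, Complex.re_ofReal_mul,
    Complex.im_ofReal_mul, UpperHalfPlane.coe_im]

end Solution

/-! ### Signs at a spatial minimum, and periodicity. -/

/-- A negative second derivative would make the minimum also a local maximum, hence `f` locally
constant with second derivative zero. -/
lemma deriv_deriv_nonneg_of_isMin {f : ℝ → ℝ} {u : ℝ} (hf : ContinuousAt f u)
    (hmin : ∀ x, f u ≤ f x) : 0 ≤ deriv (deriv f) u := by
  by_contra! h
  have h0 : deriv f u = 0 :=
    IsLocalMin.deriv_eq_zero (Filter.Eventually.of_forall hmin)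
  have hmax := isLocalMax_of_deriv_deriv_neg h h0 hf
  have hc : f =ᶠ[nhds u] fun _ => f u := by
    filter_upwards [hmax] with x hx using le_antisymm hx (hmin x)
  have := hc.deriv.deriv_eq
  simp at this
  exact h.ne this

lemma periodic_curvature (σ : ℤˣ) {γ : ℝ → ℍ} (hγ : Function.Periodic γ (2 * Real.pi)) :
    Function.Periodic (curvature σ γ) (2 * Real.pi) := by
  have hd {f : ℝ → ℂ} (hf : Function.Periodic f (2 * Real.pi)) :
      Function.Periodic (deriv f) (2 * Real.pi) := fun x => by
    rw [← deriv_comp_add_const, funext hf]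
  have hv : Function.Periodic (velocity γ) (2 * Real.pi) :=
    hd fun x => congrArg (fun z : ℍ => (z : ℂ)) (hγ x)
  have hs : Function.Periodic (speed γ) (2 * Real.pi) := fun x => by
    rw [speed, hγ x, hv x, speed]
  have ht : Function.Periodic (tangent γ) (2 * Real.pi) := fun x => by
    rw [tangent, hs x, hv x, tangent]
  intro x
  rw [curvature, curvature, normal, normal, covDeriv, covDeriv, hγ x, hv x, hs x, ht x, hd ht x]

lemma IsSmoothClosedCurve.speed_pos {γ : ℝ → ℍ} (hγ : IsSmoothClosedCurve γ) (u : ℝ) :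
    0 < speed γ u := by
  rw [speed_eq]
  exact div_pos (norm_pos_iff.2 (hγ.regular u)) (γ u).im_pos

lemma IsSmoothClosedCurve.continuous_speed {γ : ℝ → ℍ} (hγ : IsSmoothClosedCurve γ) :
    Continuous (speed γ) := by
  rw [funext (speed_eq γ)]
  exact (hγ.smooth.continuous_deriv (by simp)).norm.div
    (Complex.continuous_im.comp hγ.smooth.continuous) fun u => (γ u).im_pos.ne'

/-- The weighted mean of a continuous function is at most any upper bound. -/
lemma weighted_mean_le {w f : ℝ → ℝ} {M : ℝ} (hw : Continuous w) (hw0 : ∀ u, 0 < w u)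
    (hf : Continuous f) (hM : ∀ u, f u ≤ M) :
    1 / (∫ u in (0 : ℝ)..(2 * Real.pi), w u) * (∫ u in (0 : ℝ)..(2 * Real.pi), f u * w u) ≤ M := by
  have hpos : 0 < ∫ u in (0 : ℝ)..(2 * Real.pi), w u :=
    intervalIntegral.intervalIntegral_pos_of_pos (hw.intervalIntegrable _ _) hw0 Real.two_pi_pos
  have hle : (∫ u in (0 : ℝ)..(2 * Real.pi), f u * w u)
      ≤ ∫ u in (0 : ℝ)..(2 * Real.pi), M * w u :=
    intervalIntegral.integral_mono_on Real.two_pi_pos.le ((hf.mul hw).intervalIntegrable _ _)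
      ((continuous_const.mul hw).intervalIntegrable _ _)
      fun u _ => mul_le_mul_of_nonneg_right (hM u) (hw0 u).le
  rw [intervalIntegral.integral_const_mul] at hle
  rw [one_div, inv_mul_le_iff₀ hpos]
  exact hle.trans_eq (mul_comm _ _)

/-- A mean of `κ^α` is at most its maximum, attained where `κ` is least because `α < 0`. Convexity
makes the weight `κ ds` positive. -/
lemma IsSmoothClosedCurve.flowSpeed_nonpos (i : FlowKind) {α : ℝ} (hα : α < 0) {σ : ℤˣ}
    {γ : ℝ → ℍ} (hγ : IsSmoothClosedCurve γ) (hc : Continuous (curvature σ γ))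
    (hpos : IsConvex σ γ) {u : ℝ} (hu : ∀ x, curvature σ γ u ≤ curvature σ γ x) :
    flowSpeed i α σ γ u ≤ 0 := by
  have hca : Continuous fun x => curvature σ γ x ^ α :=
    hc.rpow_const fun x => Or.inl (hpos x).ne'
  have hM : ∀ x, curvature σ γ x ^ α ≤ curvature σ γ u ^ α := fun x =>
    Real.rpow_le_rpow_of_nonpos (hpos u) (hu x) hα.le
  rw [flowSpeed, sub_nonpos]
  cases i with
  | areaPreserving =>
    have := weighted_mean_le hγ.continuous_speed hγ.speed_pos hca hM
    simpa only [phi, length, curveIntegral, one_mul] using this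
  | lengthPreserving =>
    have := weighted_mean_le (hc.mul hγ.continuous_speed)
      (fun x => mul_pos (hpos x) (hγ.speed_pos x)) hca hM
    simp only [phi, curveIntegral]
    have e : (fun x => curvature σ γ x ^ (α + 1) * speed γ x)
        = fun x => curvature σ γ x ^ α * (curvature σ γ x * speed γ x) := by
      funext x; rw [Real.rpow_add_one (hpos x).ne', mul_assoc]
    rw [e]
    exact this

/-! ### The minimum principle. -/

/-- A minimum principle for a family of periodic functions: a lower bound `c ≤ 1` persists if the
function has nonnegative time derivative at every spatial minimum with value in `(0, 1)`. -/
lemma le_of_deriv_nonneg_at_min {I : Set ℝ} (hI : ∀ t ∈ I, ∀ s, 0 ≤ s → s ≤ t → s ∈ I)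
    {k : ℝ → ℝ → ℝ} {c P : ℝ} (hP : 0 < P)
    (hk : ContinuousOn (fun p : ℝ × ℝ => k p.1 p.2) (I ×ˢ univ))
    (hper : ∀ t ∈ I, Function.Periodic (k t) P) (hc0 : 0 < c) (hc1 : c ≤ 1)
    (hinit : ∀ u, c ≤ k 0 u)
    (hmin : ∀ t ∈ I, 0 < t → ∀ u, (∀ x, k t u ≤ k t x) → 0 < k t u → k t u < 1 →
      ∃ d, 0 ≤ d ∧ HasDerivAt (fun τ => k τ u) d t)
    {t : ℝ} (h0 : 0 ≤ t) (ht : t ∈ I) (u : ℝ) : c ≤ k t u := by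
  by_contra! hlt
  -- The barrier `c - ε (1 + s)` stays positive up to time `t` and still exceeds `k t u` at time
  -- `t`. The `1` in `1 + s` puts it strictly below the initial data.
  obtain ⟨ε, hε, hε1, hε2⟩ : ∃ ε, 0 < ε ∧ ε * (1 + t) < c ∧ ε * (1 + t) < c - k t u := by
    have hmn : 0 < min c (c - k t u) := lt_min hc0 (by linarith)
    refine ⟨min c (c - k t u) / (2 * (1 + t)), by positivity, ?_, ?_⟩
    · have : min c (c - k t u) / (2 * (1 + t)) * (1 + t) = min c (c - k t u) / 2 := by field_simp
      rw [this]; linarith [min_le_left c (c - k t u)]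
    · have : min c (c - k t u) / (2 * (1 + t)) * (1 + t) = min c (c - k t u) / 2 := by field_simp
      rw [this]; linarith [min_le_right c (c - k t u)]
  have hIcc : ∀ s ∈ Icc 0 t, s ∈ I := fun s hs => hI t ht s hs.1 hs.2
  set R : Set (ℝ × ℝ) := Icc 0 t ×ˢ Icc 0 P
  have hR : IsCompact R := isCompact_Icc.prod isCompact_Icc
  have hg : ContinuousOn (fun p : ℝ × ℝ => k p.1 p.2 + ε * (1 + p.1)) R :=
    (hk.mono (prod_mono hIcc (subset_univ _))).add (by fun_prop)
  -- The points on or below the barrier within one period; compactness provides a first contact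
  -- time.
  set K : Set (ℝ × ℝ) := R ∩ (fun p : ℝ × ℝ => k p.1 p.2 + ε * (1 + p.1)) ⁻¹' Iic c
  have hK : IsCompact K :=
    hR.of_isClosed_subset (hg.preimage_isClosed_of_isClosed hR.isClosed isClosed_Iic)
      inter_subset_left
  have mem_K : ∀ s ∈ Icc 0 t, ∀ x, k s x + ε * (1 + s) ≤ c →
      ∃ y, (s, y) ∈ K ∧ k s y = k s x := by
    intro s hs x hx
    obtain ⟨y, hy, hxy⟩ := (hper s (hIcc s hs)).exists_mem_Ico₀ hP x
    refine ⟨y, ⟨⟨hs, hy.1, hy.2.le⟩, ?_⟩, hxy.symm⟩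
    simpa [← hxy] using hx
  obtain ⟨y, hy, -⟩ := mem_K t ⟨h0, le_rfl⟩ u (by linarith)
  obtain ⟨⟨s, x⟩, hsx, hleast⟩ := hK.exists_isMinOn ⟨_, hy⟩ continuous_fst.continuousOn
  have hs : s ∈ Icc 0 t := hsx.1.1
  have hkx : k s x + ε * (1 + s) ≤ c := hsx.2
  have hbefore : ∀ r ∈ Ico 0 s, ∀ z, c < k r z + ε * (1 + r) := by
    intro r hr z
    by_contra! hle
    obtain ⟨w, hw, -⟩ := mem_K r ⟨hr.1, hr.2.le.trans hs.2⟩ z hle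
    exact absurd (hleast hw) (not_le.2 hr.2)
  have hs0 : 0 < s := by
    refine lt_of_le_of_ne hs.1 fun h => ?_
    subst h
    linarith [hinit x]
  -- By continuity from earlier times, the function is nowhere below the barrier at the contact
  -- time. So `x` is a spatial minimum, with value `c - ε (1 + s)` in `(0, 1)`.
  have hat : ∀ z, c ≤ k s z + ε * (1 + s) := by
    intro z
    have hcl : closure (Ico 0 s) = Icc 0 s := closure_Ico hs0.ne
    have hcont : ContinuousOn (fun r => k r z + ε * (1 + r)) (closure (Ico 0 s)) := by
      rw [hcl]
      refine ContinuousOn.add ?_ (by fun_prop)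
      exact hk.comp (f := fun r : ℝ => (r, z)) (by fun_prop)
        fun r hr => ⟨hIcc r ⟨hr.1, hr.2.trans hs.2⟩, mem_univ _⟩
    exact le_on_closure (f := fun _ => c) (fun r hr => (hbefore r hr z).le) continuousOn_const
      hcont (by rw [hcl]; exact ⟨hs0.le, le_rfl⟩)
  have hst : ε * (1 + s) ≤ ε * (1 + t) := by gcongr; exact hs.2
  have hεs : 0 < ε * (1 + s) := mul_pos hε (by linarith)
  obtain ⟨d, hd0, hd⟩ := hmin s (hIcc s hs) hs0 x (fun z => by linarith [hat z])
    (by linarith [hat x]) (by linarith)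
  have hd' : HasDerivAt (fun r => k r x + ε * (1 + r)) (d + ε) s := by
    exact (hd.add (((hasDerivAt_id s).const_add 1).const_mul ε)).congr_deriv (by rw [mul_one])
  have hslope := (hasDerivAt_iff_tendsto_slope_left_right.1 hd').1
  -- The perturbed function is above `c` before time `s` and at most `c` at time `s`, so its left
  -- slopes are nonpositive, against `d + ε > 0`.
  have : d + ε ≤ 0 := by
    refine le_of_tendsto hslope ?_
    filter_upwards [Ico_mem_nhdsLT hs0] with r hr
    rw [slope_def_field]
    exact div_nonpos_of_nonneg_of_nonpos (by linarith [hbefore r hr x]) (by linarith [hr.2])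
  linarith

/-! ### Application to the flow. -/

lemma zero_mem_timeInterval {T : EReal} (hT : 0 < T) : (0 : ℝ) ∈ timeInterval T :=
  ⟨le_rfl, by simpa using hT⟩

section Solution

variable {i : FlowKind} {α : ℝ} {σ : ℤˣ} {T : EReal} {X₀ : ℝ → ℍ} {X : ℝ → ℝ → ℍ}

lemma IsSolution.contDiff_curvature (hX : IsSolution i α σ T X₀ X) (hT : 0 < T) {t : ℝ}
    (ht : t ∈ timeInterval T) : ContDiff ℝ ∞ (curvature σ (X t)) :=
  contDiff_slice (hX.contDiffOn_curvature hT) ht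

lemma IsSolution.exists_deriv_nonneg_at_min (hX : IsSolution i α σ T X₀ X) (hT : 0 < T)
    (hα : α < 0) {t : ℝ} (h0 : 0 < t) (ht : t ∈ timeInterval T) {u : ℝ}
    (hu : ∀ x, curvature σ (X t) u ≤ curvature σ (X t) x) (hpos : 0 < curvature σ (X t) u)
    (hlt : curvature σ (X t) u < 1) :
    ∃ d, 0 ≤ d ∧ HasDerivAt (fun τ => curvature σ (X τ) u) d t := by
  have hc := hX.contDiff_curvature hT ht
  have hconv : IsConvex σ (X t) := fun x => hpos.trans_le (hu x)
  have hF : ContDiff ℝ ∞ (flowSpeed i α σ (X t)) :=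
    contDiff_const.sub (hc.rpow_const_of_ne fun x => (hconv x).ne')
  have hFmin : ∀ x, flowSpeed i α σ (X t) u ≤ flowSpeed i α σ (X t) x := fun x =>
    sub_le_sub_left (Real.rpow_le_rpow_of_nonpos hpos (hu x) hα.le) _
  refine ⟨_, ?_, hX.hasDerivAt_curvature hT h0 ht hF
    (IsLocalMin.deriv_eq_zero (Filter.Eventually.of_forall hu))
    (IsLocalMin.deriv_eq_zero (Filter.Eventually.of_forall hFmin))⟩
  have h1 := deriv_deriv_nonneg_of_isMin hF.continuous.continuousAt hFmin
  have h2 := (hX.closed t ht).flowSpeed_nonpos i hα hc.continuous hconv hu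
  -- The reaction term is a product of two nonpositive factors, `F ≤ 0` and `κ² - 1 < 0`; this is
  -- where `κ < 1` enters and why the bound is capped at `1`.
  exact add_nonneg (mul_nonneg h1 (sq_nonneg _))
    (mul_nonneg_of_nonpos_of_nonpos h2 (by nlinarith))

end Solution

end HypFlow
end

theorem lemma3p1 (i : HypFlow.FlowKind) (α : ℝ) (hα : α < 0) (σ : ℤˣ) (T : EReal) (hT : 0 < T)
    (X₀ : ℝ → ℍ) (hX₀ : HypFlow.IsSmoothClosedCurve X₀) (hconv : HypFlow.IsConvex σ X₀)
    (X : ℝ → ℝ → ℍ) (hX : HypFlow.IsSolution i α σ T X₀ X) :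
    ∃ m : ℝ, IsLeast (Set.range (HypFlow.curvature σ X₀)) m ∧ 0 < m ∧
      ∀ t : ℝ, 0 < t → (t : EReal) < T →
        HypFlow.IsConvex σ (X t) ∧ ∀ u : ℝ, min m 1 ≤ HypFlow.curvature σ (X t) u := by
  have h0 := HypFlow.zero_mem_timeInterval hT
  have hcont : Continuous (HypFlow.curvature σ X₀) := by
    rw [← hX.initial]
    exact (hX.contDiff_curvature hT h0).continuous
  -- The minimum over one compact period is global by periodicity.
  obtain ⟨u₀, -, hu₀⟩ := isCompact_Icc.exists_isMinOn
    (nonempty_Icc.2 Real.two_pi_pos.le) hcont.continuousOn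
  have hmin : ∀ x, HypFlow.curvature σ X₀ u₀ ≤ HypFlow.curvature σ X₀ x := by
    intro x
    obtain ⟨y, hy, hxy⟩ :=
      (HypFlow.periodic_curvature σ hX₀.periodic).exists_mem_Ico₀ Real.two_pi_pos x
    rw [hxy]
    exact hu₀ ⟨hy.1, hy.2.le⟩
  have hpos : 0 < min (HypFlow.curvature σ X₀ u₀) 1 := lt_min (hconv u₀) one_pos
  refine ⟨_, ⟨⟨u₀, rfl⟩, forall_mem_range.2 hmin⟩, hconv u₀, fun t ht htT => ?_⟩
  have key : ∀ u, min (HypFlow.curvature σ X₀ u₀) 1 ≤ HypFlow.curvature σ (X t) u :=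
    HypFlow.le_of_deriv_nonneg_at_min (I := HypFlow.timeInterval T)
      (k := fun t => HypFlow.curvature σ (X t))
      (fun t ht s hs hst => ⟨hs, lt_of_le_of_lt (EReal.coe_le_coe_iff.2 hst) ht.2⟩)
      Real.two_pi_pos (hX.contDiffOn_curvature hT).continuousOn
      (fun t ht => HypFlow.periodic_curvature σ (hX.closed t ht).periodic) hpos (min_le_right _ _)
      (fun u => by rw [hX.initial]; exact (min_le_left _ _).trans (hmin u))
      (fun t ht ht0 u hu hu0 hu1 => hX.exists_deriv_nonneg_at_min hT hα ht0 ht hu hu0 hu1)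
      ht.le ⟨ht.le, htT⟩
  exact ⟨fun u => hpos.trans_le (key u), key⟩
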